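/- Let $G$ be a finitely generated group and let $H \le L \le G$ be subgroups with $H$ and $L$ finitely generated. If $H$ is stable in $G$, then $H$ is stable in $L$. Here stability is defined as follows. A $(\kappa,\lambda)$-quasi-isometric embedding of metric spaces $\phi\colon X\to Y$ (with $\kappa\ge 1$, $\lambda>0$) is a map, not necessarily continuous, satisfying $\frac1\kappa d_X(a,b)-\lambda\le d_Y(\phi(a),\phi(b))\le \kappa\, d_X(a,b)+\lambda$ for all $a,b\in X$. A $\kappa$-quasigeodesic in $Y$ from $a$ to $b$ is a $(\kappa,\kappa)$-quasi-isometric embedding of a compact interval of $\mathbb R$ into $Y$ that sends the left endpoint to $a$ and the right endpoint to $b$. Two subsets are $D$-Hausdorff close if each lies in the $D$-neighborhood of the other. A finitely generated subgroup $A$ of a finitely generated group $B$ is stable in $B$ if, for word metrics $d_T$ on $A$ and $d_S$ on $B$ associated with finite generating sets $T$ of $A$ and $S$ of $B$, 1. the inclusion $(A,d_T)\to(B,d_S)$ is a quasi-isometric embedding (for some constants $\kappa,\lambda$), and 2. for every $\kappa>1$ there is $D>0$ such that any two $\kappa$-quasigeodesics in $(B,d_S)$ with the same endpoints $a,b\in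 A$ have $D$-Hausdorff close images. The theorem asserts this independently of the generating sets: if conditions 1 and 2 hold for $H$ in $G$ for some choice of finite generating sets of $H$ and $G$, then they hold for $H$ in $L$ for every choice of finite generating sets of $H$ and $L$. -/

import Mathlib

namespace SubgroupStability

section MetricSpaces

variable {X Y : Type*} [PseudoMetricSpace X] [PseudoMetricSpace Y]

/-- The `(κ, c)`-quasi-isometric embedding inequalities for a map of metric spaces. -/
def IsQIEmbeddingWith (κ c : ℝ) (φ : X → Y) : Prop :=
  ∀ a b : X, 1 / κ * dist a b - c ≤ dist (φ a) (φ b) ∧ dist (φ a) (φ b) ≤ κ * dist a b + c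

/-- A map is a quasi-isometric embedding if it is a `(κ, c)`-quasi-isometric embedding for some
`κ ≥ 1` and `c > 0`. -/
def IsQIEmbedding (φ : X → Y) : Prop :=
  ∃ κ c : ℝ, 1 ≤ κ ∧ 0 < c ∧ IsQIEmbeddingWith κ c φ

/-- An injective map `i : X → Y` exhibits `X` as undistorted in `Y`. -/
def IsUndistorted (i : X → Y) : Prop :=
  Function.Injective i ∧ IsQIEmbedding i

/-- Two subsets lie in the `D`-neighbourhoods of each other. -/
def HausdorffClose (D : ℝ) (A B : Set X) : Prop :=
  A ⊆ Metric.thickening D B ∧ B ⊆ Metric.thickening D A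

/-- `q` is a `κ`-quasigeodesic, that is, a `(κ, κ)`-quasi-isometric embedding of the compact
interval `[s, t]` (not necessarily continuous), with initial point `a` and terminal point `b`. -/
def IsQuasigeodesicBetween (κ : ℝ) {s t : ℝ} (q : Set.Icc s t → X) (a b : X) : Prop :=
  IsQIEmbeddingWith κ κ q ∧
    ∃ hst : s ≤ t, q ⟨s, Set.left_mem_Icc.2 hst⟩ = a ∧ q ⟨t, Set.right_mem_Icc.2 hst⟩ = b

/-- For every `κ > 1`, any two `κ`-quasigeodesics of `X` with the same endpoints in `A` are
uniformly Hausdorff close. -/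
def QuasigeodesicsFellowTravel (A : Set X) : Prop :=
  ∀ κ : ℝ, 1 < κ → ∃ D : ℝ, 0 < D ∧
    ∀ (s t s' t' : ℝ) (q : Set.Icc s t → X) (q' : Set.Icc s' t' → X), ∀ a ∈ A, ∀ b ∈ A,
      IsQuasigeodesicBetween κ q a b → IsQuasigeodesicBetween κ q' a b →
        HausdorffClose D (Set.range q) (Set.range q')

/-- `Y` (with its own metric, included by `i`) is an undistorted and stable subspace of `X`. -/
def IsStableSubspace (i : Y → X) : Prop :=
  IsUndistorted i ∧ QuasigeodesicsFellowTravel (Set.range i)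

end MetricSpaces

section WordMetric

/-- A finite generating set of a group. -/
structure FinGenSet (G : Type*) [Group G] where
  carrier : Set G
  finite : carrier.Finite
  closure_eq_top : Subgroup.closure carrier = ⊤

variable {G : Type*} [Group G]

/-- `l` is a word in the letters `S ∪ S⁻¹`. -/
def IsWord (S : Set G) (l : List G) : Prop :=
  ∀ x ∈ l, x ∈ S ∨ x⁻¹ ∈ S

/-- The word norm: the least length of a word in `S ∪ S⁻¹` representing `g`. -/
noncomputable def wordNorm (S : Set G) (g : G) : ℕ :=
  sInf {n : ℕ | ∃ l : List G, IsWord S l ∧ l.prod = g ∧ l.length = n}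

theorem FinGenSet.exists_word (S : FinGenSet G) (g : G) :
    ∃ l : List G, IsWord S.carrier l ∧ l.prod = g ∧ l.length = wordNorm S.carrier g := by
  refine Nat.sInf_mem
    (s := {n : ℕ | ∃ l : List G, IsWord S.carrier l ∧ l.prod = g ∧ l.length = n}) ?_
  have hg : g ∈ Subgroup.closure S.carrier := S.closure_eq_top ▸ Subgroup.mem_top g
  rw [← Subgroup.mem_toSubmonoid, Subgroup.closure_toSubmonoid] at hg
  obtain ⟨l, hl, hp⟩ := Submonoid.exists_list_of_mem_closure hg
  exact ⟨l.length, l, hl, hp, rfl⟩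

theorem wordNorm_le {S : Set G} {l : List G} (hl : IsWord S l) : wordNorm S l.prod ≤ l.length :=
  Nat.sInf_le ⟨l, hl, rfl, rfl⟩

theorem wordNorm_one (S : Set G) : wordNorm S (1 : G) = 0 :=
  Nat.le_zero.1 (wordNorm_le (S := S) (l := []) (by simp [IsWord]))

theorem FinGenSet.wordNorm_mul_le (S : FinGenSet G) (g h : G) :
    wordNorm S.carrier (g * h) ≤ wordNorm S.carrier g + wordNorm S.carrier h := by
  obtain ⟨l, hl, rfl, hn⟩ := S.exists_word g
  obtain ⟨m, hm, rfl, hk⟩ := S.exists_word h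
  rw [← hn, ← hk, ← List.length_append, ← List.prod_append]
  refine wordNorm_le fun x hx => ?_
  rcases List.mem_append.1 hx with h | h
  exacts [hl x h, hm x h]

theorem FinGenSet.wordNorm_inv_le (S : FinGenSet G) (g : G) :
    wordNorm S.carrier g⁻¹ ≤ wordNorm S.carrier g := by
  obtain ⟨l, hl, rfl, hn⟩ := S.exists_word g
  rw [← hn, List.prod_inv_reverse]
  refine (wordNorm_le fun x hx => ?_).trans (by simp)
  rw [List.mem_reverse, List.mem_map] at hx
  obtain ⟨y, hy, rfl⟩ := hx
  rw [inv_inv]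
  exact (hl y hy).symm

/-- The left-invariant word metric `d(g, h) = |g⁻¹ h|_S`. -/
noncomputable def wordDist (S : Set G) (g h : G) : ℕ :=
  wordNorm S (g⁻¹ * h)

theorem wordDist_self (S : Set G) (g : G) : wordDist S g g = 0 := by
  rw [wordDist, inv_mul_cancel, wordNorm_one]

theorem FinGenSet.wordDist_comm (S : FinGenSet G) (g h : G) :
    wordDist S.carrier g h = wordDist S.carrier h g := by
  have key : ∀ a b : G, wordDist S.carrier a b ≤ wordDist S.carrier b a :=
    fun a b => by simpa [wordDist] using S.wordNorm_inv_le (b⁻¹ * a)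
  exact le_antisymm (key g h) (key h g)

theorem FinGenSet.wordDist_triangle (S : FinGenSet G) (a b c : G) :
    wordDist S.carrier a c ≤ wordDist S.carrier a b + wordDist S.carrier b c := by
  simpa [wordDist, mul_assoc] using S.wordNorm_mul_le (a⁻¹ * b) (b⁻¹ * c)

theorem FinGenSet.eq_of_wordDist_eq_zero (S : FinGenSet G) {a b : G}
    (h : wordDist S.carrier a b = 0) : a = b := by
  obtain ⟨l, -, hp, hn⟩ := S.exists_word (a⁻¹ * b)
  rw [show wordNorm S.carrier (a⁻¹ * b) = 0 from h, List.length_eq_zero_iff] at hn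
  rw [hn, List.prod_nil] at hp
  exact inv_mul_eq_one.1 hp.symm

/-- The group `G` regarded as a metric space with the word metric of the generating set `S`. -/
def FinGenSet.Space (_S : FinGenSet G) : Type _ := G

noncomputable instance FinGenSet.instMetricSpace (S : FinGenSet G) : MetricSpace S.Space where
  dist g h := (wordDist S.carrier (G := G) g h : ℝ)
  dist_self g := Nat.cast_eq_zero.2 (wordDist_self S.carrier (G := G) g)
  dist_comm g h := congrArg Nat.cast (S.wordDist_comm g h)
  dist_triangle a b c := by exact_mod_cast S.wordDist_triangle a b c
  eq_of_dist_eq_zero {a b} h := S.eq_of_wordDist_eq_zero (Nat.cast_eq_zero.1 h)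

/-- The inclusion of a subgroup, as a map between the spaces with word metrics. -/
def inclusion {H : Subgroup G} (T : FinGenSet H) (S : FinGenSet G) : T.Space → S.Space :=
  fun h => H.subtype h

/-- The subgroup `H` of `G` is stable, as measured by the word metric of `S` on `G` and the word
metric of `T` on `H`. -/
def IsStableSubgroupWith (H : Subgroup G) (T : FinGenSet H) (S : FinGenSet G) : Prop :=
  IsStableSubspace (inclusion T S)

end WordMetric

end SubgroupStability

/-!
Stability of `H` in `G` passes to an intermediate finitely generated group `L`, although `L` may be
distorted in `G`, so that quasigeodesics of `L` need not be quasigeodesics of `G`.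

Stability in `G` first gives sublinear contraction of nearest-point projections to `H`
(`exists_contraction`): a ball of radius `r / 2` centred at a large distance `r` from `H` projects
into a ball of radius `ε r`. The reason is a straightening procedure
(`IsDiscreteQuasigeodesic.exists_extend_path`), which turns a path into a quasigeodesic with
constant `c` at the expense of moving it by about `c` times its length. If the projections `y`, `y'`
of `x`, `x'` were far apart, straightening the path through `y`, `x`, `x'`, `y'` would yield a
quasigeodesic with controlled constant straying far from `H`, although its endpoints are in `H`.

A quasigeodesic of `L` with endpoints in `H` is a Lipschitz path in `G`. While it is far from `H`,
its projection to `H` moves slowly by contraction (`dist_proj_path_le`). On the other hand, `H` is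
undistorted in `G`, and balls of `G` are finite, so that points of `L` close in `G` are close in
`L`. Hence an excursion of length `n` away from `H` moves the projection by an amount linear in `n`,
and excursions have bounded length (`exists_bound_dist_of_quasigeodesic`). The quasigeodesic can
therefore be pushed to `H` within a bounded distance of `L`, where it is a quasigeodesic of `G`. Two
such quasigeodesics fellow travel in `G` by hypothesis, hence also in `L`
(`quasigeodesicsFellowTravel_of_comp`).
-/

namespace SubgroupStability

/-! ### Straightening discrete paths -/

section DiscretePaths

variable {X : Type*} [PseudoMetricSpace X]

/-- Any two points are joined by a geodesic defined on an initial segment `{0, …, n}` of `ℕ`; in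
particular all distances are natural numbers. Word metrics are the motivating example. -/
def IsIntegerGeodesic (X : Type*) [PseudoMetricSpace X] : Prop :=
  ∀ x y : X, ∃ (n : ℕ) (γ : ℕ → X), γ 0 = x ∧ γ n = y ∧
    ∀ i j : ℕ, i ≤ j → j ≤ n → dist (γ i) (γ j) = (j : ℝ) - i

/-- `g`, restricted to `{0, …, m}`, is `1`-Lipschitz and expands distances by at least the
factor `c`. Values of `g` beyond `m` are irrelevant. -/
def IsDiscreteQuasigeodesic (c : ℝ) (m : ℕ) (g : ℕ → X) : Prop :=
  ∀ i j : ℕ, i ≤ j → j ≤ m →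
    c * ((j : ℝ) - i) ≤ dist (g i) (g j) ∧ dist (g i) (g j) ≤ (j : ℝ) - i

/-- The distance to `z` penalised by `c` times the arc length is minimised at some point of `g`.
Leaving `g` there along a geodesic to `z` does not worsen the constant `c`. -/
theorem IsDiscreteQuasigeodesic.exists_extend_point (hX : IsIntegerGeodesic X) {c : ℝ}
    (hc0 : 0 < c) (hc1 : c ≤ 1) {m : ℕ} {g : ℕ → X} (hg : IsDiscreteQuasigeodesic c m g) {z : X}
    (hz : dist (g m) z ≤ 1) :
    ∃ (m' : ℕ) (g' : ℕ → X), g' 0 = g 0 ∧ g' m' = z ∧ m' ≤ m + 1 ∧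
      IsDiscreteQuasigeodesic c m' g' ∧
      ∀ i ≤ m', (∃ k ≤ m, g' i = g k) ∨ dist (g' i) z ≤ 1 + c * m := by
  obtain ⟨i₀, hi₀, hmin⟩ := Finset.exists_min_image (Finset.range (m + 1))
    (fun i => dist (g i) z + c * i) ⟨0, by simp⟩
  have hi₀m : i₀ ≤ m := by simpa [Nat.lt_succ_iff] using hi₀
  have hmin' : ∀ i ≤ m, dist (g i₀) z + c * i₀ ≤ dist (g i) z + c * i := fun i hi =>
    hmin i (by simpa [Nat.lt_succ_iff] using hi)
  obtain ⟨w, γ, hγ0, hγw, hγ⟩ := hX (g i₀) z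
  have hw : dist (g i₀) z = w := by
    have := hγ 0 w (Nat.zero_le _) le_rfl
    rw [hγ0, hγw] at this
    simpa using this
  have hi₀r : (i₀ : ℝ) ≤ m := by exact_mod_cast hi₀m
  have hw1 : (w : ℝ) + c * i₀ ≤ 1 + c * m := by
    have := hmin' m le_rfl
    linarith
  refine ⟨i₀ + w, fun i => if i ≤ i₀ then g i else γ (i - i₀), by simp, ?_, ?_, ?_, ?_⟩
  · by_cases h : w = 0
    · subst h
      simp [← hγw, hγ0]
    · simp [h, hγw]
  · have : ((i₀ + w : ℕ) : ℝ) ≤ ((m + 1 : ℕ) : ℝ) := by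
      push_cast
      nlinarith [mul_nonneg (sub_nonneg.2 hc1) (sub_nonneg.2 hi₀r)]
    exact_mod_cast this
  · intro i j hij hj
    have hijr : (i : ℝ) ≤ j := by exact_mod_cast hij
    by_cases hji : j ≤ i₀
    · simp only [hji, hij.trans hji, if_true]
      exact hg i j hij (hji.trans hi₀m)
    · have hjr : (i₀ : ℝ) ≤ j := by exact_mod_cast (not_le.1 hji).le
      obtain ⟨t, rfl⟩ := Nat.exists_eq_add_of_le (not_le.1 hji).le
      have htw : t ≤ w := by omega
      by_cases hii : i ≤ i₀
      · have hir : (i : ℝ) ≤ i₀ := by exact_mod_cast hii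
        simp only [hji, hii, if_true, if_false, Nat.add_sub_cancel_left]
        have h1 := hmin' i (hii.trans hi₀m)
        have h2 := hγ t w htw le_rfl
        have h3 := hγ 0 t (Nat.zero_le _) htw
        rw [hγw] at h2
        rw [hγ0] at h3
        have h4 := (hg i i₀ hii hi₀m).2
        have h5 := dist_triangle (g i) (γ t) z
        have h6 := dist_triangle (g i) (g i₀) (γ t)
        have ht0 : (0 : ℝ) ≤ t := Nat.cast_nonneg t
        push_cast at *
        constructor
        · nlinarith
        · linarith
      · obtain ⟨u, rfl⟩ := Nat.exists_eq_add_of_le (not_le.1 hii).le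
        simp only [hji, hii, if_false, Nat.add_sub_cancel_left]
        rw [hγ u t (by omega) htw]
        push_cast at *
        constructor
        · nlinarith
        · linarith
  · intro i hi
    by_cases hii : i ≤ i₀
    · exact Or.inl ⟨i, hii.trans hi₀m, by simp [hii]⟩
    · right
      obtain ⟨u, rfl⟩ := Nat.exists_eq_add_of_le (not_le.1 hii).le
      simp only [hii, if_false, Nat.add_sub_cancel_left]
      have h2 := hγ u w (by omega) le_rfl
      rw [hγw] at h2
      have hu0 : (0 : ℝ) ≤ u := Nat.cast_nonneg u
      have : 0 ≤ c * i₀ := by positivity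
      linarith

/-- Straightening: a discrete quasigeodesic followed by an arbitrary path with unit steps can be
replaced by a discrete quasigeodesic with the *same* constant `c`, whose new points stay close to
the path, up to an error of `c` times the total length. -/
theorem IsDiscreteQuasigeodesic.exists_extend_path (hX : IsIntegerGeodesic X) {c : ℝ}
    (hc0 : 0 < c) (hc1 : c ≤ 1) {m : ℕ} {g : ℕ → X} (hg : IsDiscreteQuasigeodesic c m g)
    {f : ℕ → X} (hf0 : f 0 = g m) (n : ℕ) (hf : ∀ k < n, dist (f k) (f (k + 1)) ≤ 1) :
    ∃ (m' : ℕ) (g' : ℕ → X), g' 0 = g 0 ∧ g' m' = f n ∧ m' ≤ m + n ∧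
      IsDiscreteQuasigeodesic c m' g' ∧
      ∀ i ≤ m', (∃ k ≤ m, g' i = g k) ∨ ∃ k ≤ n, dist (g' i) (f k) ≤ 1 + c * (m + n) := by
  induction n with
  | zero => exact ⟨m, g, rfl, hf0.symm, le_rfl, hg, fun i hi => Or.inl ⟨i, hi, rfl⟩⟩
  | succ n ih =>
    obtain ⟨m₁, g₁, h0, hm, hmn, hg₁, hcl⟩ := ih fun k hk => hf k (by omega)
    obtain ⟨m₂, g₂, h0', hm', hmn', hg₂, hcl'⟩ := hg₁.exists_extend_point hX hc0 hc1
      (z := f (n + 1)) (by rw [hm]; exact hf n (by omega))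
    have hm₁ : (m₁ : ℝ) ≤ m + n := by exact_mod_cast hmn
    refine ⟨m₂, g₂, h0'.trans h0, hm', by omega, hg₂, fun i hi => ?_⟩
    push_cast
    rcases hcl' i hi with ⟨k, hk, h⟩ | h
    · rw [h]
      rcases hcl k hk with h | ⟨l, hl, h⟩
      · exact Or.inl h
      · exact Or.inr ⟨l, by omega, h.trans (by nlinarith)⟩
    · exact Or.inr ⟨n + 1, le_rfl, h.trans (by nlinarith)⟩

end DiscretePaths

/-! ### Contraction of nearest-point projections -/

section Contraction

variable {X : Type*} [PseudoMetricSpace X]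

/-- A path that starts near `y`, ends near `y'` and never leaves the union of two balls of radius
`ρ` about these points has to jump from one ball to the other. -/
theorem dist_le_of_path_subset_balls {m : ℕ} {g : ℕ → X}
    (hg : ∀ k < m, dist (g k) (g (k + 1)) ≤ 1) {y y' : X} {ρ : ℝ} (h0 : dist (g 0) y ≤ ρ)
    (hm : dist (g m) y' ≤ ρ) (h : ∀ i ≤ m, dist (g i) y ≤ ρ ∨ dist (g i) y' ≤ ρ) :
    dist y y' ≤ 2 * ρ + 1 := by
  by_contra hcon
  have key : ∀ i ≤ m, dist (g i) y ≤ ρ := by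
    intro i
    induction i with
    | zero => exact fun _ => h0
    | succ i ih =>
      intro hi
      refine (h _ hi).resolve_right fun h' => hcon ?_
      have h1 := ih (by omega)
      have h2 := hg i (by omega)
      have h3 := dist_triangle4 y (g i) (g (i + 1)) y'
      rw [dist_comm y (g i)] at h3
      linarith
  have h1 := key m le_rfl
  have h2 := dist_triangle_left y y' (g m)
  linarith [dist_nonneg (x := g m) (y := y)]

/-- Sublinear contraction of nearest-point projections: if discrete quasigeodesics with endpoints
in `A` stay uniformly close to `A`, then a ball of radius `r / 2` centred at distance `r ≥ R` from
`A` projects into a ball of radius `ε * r`. Otherwise the path through `y`, `x`, `x'`, `y'` could be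
straightened to a quasigeodesic straying from `A`. -/
theorem exists_contraction (hX : IsIntegerGeodesic X) {A : Set X}
    (hA : ∀ c : ℝ, 0 < c → c ≤ 1 → ∃ D : ℝ, 0 < D ∧ ∀ (m : ℕ) (g : ℕ → X),
      IsDiscreteQuasigeodesic c m g → g 0 ∈ A → g m ∈ A → ∀ k ≤ m, ∃ a ∈ A, dist (g k) a < D)
    {ε : ℝ} (hε0 : 0 < ε) (hε1 : ε ≤ 1) :
    ∃ R : ℝ, 0 < R ∧ ∀ x x' y y' : X, y ∈ A → y' ∈ A → (∀ a ∈ A, dist x y ≤ dist x a) →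
      (∀ a ∈ A, dist x' y' ≤ dist x' a) → R ≤ dist x y → dist x x' ≤ dist x y / 2 →
      dist y y' ≤ ε * dist x y := by
  -- The path through `y`, `x`, `x'`, `y'` has length at most `3 r`. Straightening with `c = ε / 24`
  -- moves it by at most `1 + ε r / 8`, and this error enters the final estimate four times.
  obtain ⟨D, hD, hstab⟩ := hA (ε / 24) (by positivity) (by linarith)
  refine ⟨(4 * D + 10) / ε, by positivity, fun x x' y y' hy hy' hxy hxy' hR hxx' => ?_⟩
  set r := dist x y with hr
  set c := ε / 24 with hc
  have hRr : 4 * D + 10 ≤ ε * r := by rwa [div_le_iff₀' hε0] at hR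
  have hr0 : 0 ≤ r := dist_nonneg
  have hεr : ε * r ≤ r := by nlinarith
  obtain ⟨n₁, α, hα0, hαn, hα⟩ := hX y x
  obtain ⟨n₂, β, hβ0, hβn, hβ⟩ := hX x x'
  obtain ⟨n₃, δ, hδ0, hδn, hδ⟩ := hX x' y'
  have hn₁ : r = n₁ := by
    have := hα 0 n₁ (Nat.zero_le _) le_rfl
    rw [hα0, hαn, dist_comm] at this
    simpa using this
  have hn₂ : dist x x' = n₂ := by
    have := hβ 0 n₂ (Nat.zero_le _) le_rfl
    rw [hβ0, hβn] at this
    simpa using this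
  have hn₃ : dist x' y' = n₃ := by
    have := hδ 0 n₃ (Nat.zero_le _) le_rfl
    rw [hδ0, hδn] at this
    simpa using this
  have hn₃' : (n₃ : ℝ) ≤ n₂ + n₁ := by
    have h1 := hxy' y hy
    have h2 := dist_triangle_left x' y x
    linarith
  have hlen : (n₁ : ℝ) + n₂ + n₃ ≤ 3 * r := by linarith
  have hαq : IsDiscreteQuasigeodesic c n₁ α := fun i j hij hj => by
    have hijr : (i : ℝ) ≤ j := by exact_mod_cast hij
    rw [hα i j hij hj]
    exact ⟨by nlinarith, le_rfl⟩
  obtain ⟨m₁, g₁, h10, h1m, h1l, hg₁, h1c⟩ := hαq.exists_extend_path hX (by positivity)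
    (by linarith) (f := β) (by rw [hβ0, hαn]) n₂
    fun k hk => by rw [hβ k (k + 1) (by omega) hk]; simp
  obtain ⟨m₂, g₂, h20, h2m, h2l, hg₂, h2c⟩ := hg₁.exists_extend_path hX (by positivity)
    (by linarith) (f := δ) (by rw [hδ0, h1m, hβn]) n₃
    fun k hk => by rw [hδ k (k + 1) (by omega) hk]; simp
  have h1lr : (m₁ : ℝ) ≤ n₁ + n₂ := by exact_mod_cast h1l
  have hg0 : g₂ 0 = y := by rw [h20, h10, hα0]
  have hgm : g₂ m₂ = y' := by rw [h2m, hδn]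
  set ρ := 1 + c * (3 * r) with hρ
  have hρ0 : 0 ≤ ρ := by positivity
  have hρr : D + ρ < r / 2 := by
    rw [hρ, hc]
    linarith
  have hballs : ∀ i ≤ m₂, dist (g₂ i) y ≤ D + 2 * ρ ∨ dist (g₂ i) y' ≤ D + 2 * ρ := by
    intro i hi
    obtain ⟨a, ha, hia⟩ := hstab m₂ g₂ hg₂ (hg0 ▸ hy) (hgm ▸ hy') i hi
    rcases h2c i hi with ⟨k, hk, hik⟩ | ⟨k, hk, hik⟩
    · rcases h1c k hk with ⟨l, hl, hkl⟩ | ⟨l, hl, hkl⟩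
      · -- The point lies on `[y, x]`, where the distance to `A` is the distance to `y`.
        left
        rw [hik, hkl] at hia ⊢
        have e1 := hα 0 l (Nat.zero_le _) hl
        have e2 := hα l n₁ hl le_rfl
        rw [hα0, dist_comm] at e1
        rw [hαn, dist_comm] at e2
        have e3 := hxy a ha
        have e4 := dist_triangle x (α l) a
        push_cast at e1
        linarith
      · -- Near `[x, x']` the distance to `A` is too large.
        exfalso
        have e1 := hβ 0 l (Nat.zero_le _) hl
        rw [hβ0] at e1
        have hlr : (l : ℝ) ≤ n₂ := by exact_mod_cast hl
        have e3 := hxy a ha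
        have e4 := dist_triangle4 x (β l) (g₁ k) a
        rw [dist_comm (β l)] at e4
        rw [hik] at hia
        have e5 : 1 + c * (n₁ + n₂) ≤ ρ := by
          rw [hρ]
          gcongr
          linarith [Nat.cast_nonneg (α := ℝ) n₃]
        push_cast at e1
        linarith
    · right
      have e1 := hδ 0 k (Nat.zero_le _) hk
      have e2 := hδ k n₃ hk le_rfl
      rw [hδ0] at e1
      rw [hδn] at e2
      have e3 := hxy' a ha
      have e4 := dist_triangle4 x' (δ k) (g₂ i) a
      rw [dist_comm (δ k) (g₂ i)] at e4
      have e5 : 1 + c * (m₁ + n₃) ≤ ρ := by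
        rw [hρ]
        gcongr
        linarith
      have e6 := dist_triangle (g₂ i) (δ k) y'
      push_cast at e1
      linarith
  have hfin := dist_le_of_path_subset_balls (m := m₂) (g := g₂) (ρ := D + 2 * ρ)
    (fun k hk => by simpa using (hg₂ k (k + 1) (by omega) hk).2)
    (by rw [hg0, dist_self]; linarith) (by rw [hgm, dist_self]; linarith) hballs
  rw [hρ, hc] at hfin
  linarith

/-- A path that keeps away from `A` makes little progress in the projection: it is cut into pieces
whose length is comparable to the distance to `A`, and contraction applies to each piece. -/
theorem dist_proj_path_le {π : X → X} {R ε B : ℝ} (hε : 0 < ε) (hB : 0 < B) (hBR : 2 * B ≤ R)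
    (hπ : ∀ x x', dist x (π x) ≤ dist x x' + dist x' (π x'))
    (hcontr : ∀ x x', R ≤ dist x (π x) → dist x x' ≤ dist x (π x) / 2 →
      dist (π x) (π x') ≤ ε * dist x (π x))
    (p : ℕ → X) (d i : ℕ) (hR : ∀ k, i ≤ k → k < i + d → R ≤ dist (p k) (π (p k)))
    (hp : ∀ k, i ≤ k → k < i + d → dist (p k) (p (k + 1)) ≤ B) :
    dist (π (p i)) (π (p (i + d))) ≤
      4 * B * ε * d + ε * dist (p (i + d)) (π (p (i + d))) := by
  induction d using Nat.strong_induction_on generalizing i with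
  | _ d ih =>
    have hlip : ∀ e ≤ d, dist (p i) (p (i + e)) ≤ B * e := by
      intro e
      induction e with
      | zero => simp
      | succ e ihe =>
        intro he
        have h1 := ihe (by omega)
        have h2 := hp (i + e) (by omega) (by omega)
        have h3 := dist_triangle (p i) (p (i + e)) (p (i + e + 1))
        rw [← add_assoc]
        push_cast
        linarith
    rcases Nat.eq_zero_or_pos d with rfl | hd
    · simp only [add_zero, dist_self]
      positivity
    set h := dist (p i) (π (p i)) with hh
    have hRh : R ≤ h := hR i le_rfl (by omega)
    by_cases hshort : B * d ≤ h / 2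
    · have h1 := hcontr (p i) (p (i + d)) hRh ((hlip d le_rfl).trans hshort)
      have h2 := hπ (p i) (p (i + d))
      have h3 := hlip d le_rfl
      have h4 : 0 ≤ B * ε * d := by positivity
      nlinarith
    · -- Advance by about `h / (2 B)` steps, and at least one.
      push Not at hshort
      set e := ⌊h / (2 * B)⌋₊ with he
      have hle : (e : ℝ) ≤ h / (2 * B) := Nat.floor_le (by positivity)
      have hlt : h / (2 * B) < e + 1 := Nat.lt_floor_add_one _
      have hone : 1 ≤ e := Nat.le_floor (by rw [le_div_iff₀ (by positivity)]; push_cast; linarith)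
      have honer : (1 : ℝ) ≤ e := by exact_mod_cast hone
      rw [le_div_iff₀ (by positivity)] at hle
      rw [div_lt_iff₀ (by positivity)] at hlt
      have hed : e < d := by
        have : (e : ℝ) < d := by nlinarith
        exact_mod_cast this
      have h1 := hcontr (p i) (p (i + e)) hRh ((hlip e hed.le).trans (by linarith))
      have h2 := ih (d - e) (by omega) (i + e) (fun k hk hk' => hR k (by omega) (by omega))
        (fun k hk hk' => hp k (by omega) (by omega))
      rw [show i + e + (d - e) = i + d by omega, Nat.cast_sub hed.le] at h2
      have h3 := dist_triangle (π (p i)) (π (p (i + e))) (π (p (i + d)))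
      have h4 : ε * h ≤ ε * (4 * B * e) := by
        gcongr
        nlinarith
      nlinarith

/-- If all excursions of `h` above the level `R` are short, then `h` is bounded. -/
theorem le_of_excursions_short {h : ℕ → ℝ} {n N : ℕ} {R B : ℝ} (hB : 0 ≤ B) (h0 : h 0 ≤ R)
    (hn : h n ≤ R) (hstep : ∀ k < n, h (k + 1) ≤ h k + B)
    (hexc : ∀ i j : ℕ, i < j → j ≤ n → h i ≤ R → h j ≤ R → (∀ k, i < k → k < j → R < h k) →
      j - i ≤ N) : ∀ k ≤ n, h k ≤ R + B * N := by
  classical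
  intro k hk
  by_cases hkR : h k ≤ R
  · have : 0 ≤ B * N := by positivity
    linarith
  set i := Nat.findGreatest (fun i => h i ≤ R) k with hi
  have hiR : h i ≤ R := Nat.findGreatest_spec (P := fun i => h i ≤ R) (Nat.zero_le k) h0
  have hik : i ≤ k := Nat.findGreatest_le k
  have hex : ∃ j, k ≤ j ∧ h j ≤ R := ⟨n, hk, hn⟩
  set j := Nat.find hex with hj
  obtain ⟨hkj, hjR⟩ : k ≤ j ∧ h j ≤ R := Nat.find_spec hex
  have hjn : j ≤ n := Nat.find_min' hex ⟨hk, hn⟩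
  have hne : i ≠ k := fun e => hkR (e ▸ hiR)
  have hgap := hexc i j (by omega) hjn hiR hjR fun l hl hl' => by
    by_contra hcon
    rcases le_total l k with hlk | hlk
    · have hli : l ≤ i := Nat.le_findGreatest (P := fun i => h i ≤ R) hlk (not_lt.1 hcon)
      omega
    · exact Nat.find_min hex hl' ⟨hlk, not_lt.1 hcon⟩
  have hgrow : ∀ e, i + e ≤ n → h (i + e) ≤ R + B * e := by
    intro e
    induction e with
    | zero => exact fun _ => by simpa using hiR
    | succ e ihe =>
      intro he
      have h1 := ihe (by omega)
      have h2 := hstep (i + e) (by omega)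
      rw [← add_assoc]
      push_cast
      linarith
  have h1 := hgrow (k - i) (by omega)
  rw [Nat.add_sub_cancel' hik] at h1
  have h2 : ((k - i : ℕ) : ℝ) ≤ N := by exact_mod_cast (by omega : k - i ≤ N)
  nlinarith

end Contraction

/-! ### Quasigeodesics of an intermediate space -/

section PullingBack

variable {X Y Z : Type*} [PseudoMetricSpace X] [PseudoMetricSpace Y] [PseudoMetricSpace Z]

theorem IsQIEmbedding.of_dist_le {φ : Y → X} {C C' C'' : ℝ} (hC : 0 ≤ C) (hC' : 0 < C')
    (hC'' : 0 < C'') (h1 : ∀ y y', dist y y' ≤ C * dist (φ y) (φ y') + C')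
    (h2 : ∀ y y', dist (φ y) (φ y') ≤ C'' * dist y y') : IsQIEmbedding φ := by
  refine ⟨C + C' + C'' + 1, 1, by linarith, one_pos, fun y y' => ⟨?_, ?_⟩⟩
  · rw [sub_le_iff_le_add, one_div, inv_mul_le_iff₀ (by positivity)]
    have h3 : 0 ≤ (C' + C'' + 1) * dist (φ y) (φ y') := by positivity
    linarith [h1 y y']
  · have h3 : 0 ≤ (C + C' + 1) * dist y y' := by positivity
    linarith [h2 y y']

/-- A discrete quasigeodesic, composed with a quasi-isometric embedding and made constant between
consecutive integers, is a quasigeodesic. -/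
theorem IsDiscreteQuasigeodesic.isQuasigeodesicBetween {c : ℝ} (hc0 : 0 < c) (hc1 : c ≤ 1) {m : ℕ}
    {g : ℕ → Y} (hg : IsDiscreteQuasigeodesic c m g) {φ : Y → X} {κ c' κ' : ℝ} (hκ : 1 ≤ κ)
    (hc' : 0 ≤ c') (hφ : IsQIEmbeddingWith κ c' φ) (hκ' : κ / c + κ + c' + 1 ≤ κ') :
    IsQuasigeodesicBetween κ' (fun u : Set.Icc (0 : ℝ) m => φ (g ⌊(u : ℝ)⌋₊))
      (φ (g 0)) (φ (g m)) := by
  have hκc : 0 < κ / c := by positivity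
  have key : ∀ u v : Set.Icc (0 : ℝ) m, (u : ℝ) ≤ v →
      1 / κ' * dist u v - κ' ≤ dist (φ (g ⌊(u : ℝ)⌋₊)) (φ (g ⌊(v : ℝ)⌋₊)) ∧
        dist (φ (g ⌊(u : ℝ)⌋₊)) (φ (g ⌊(v : ℝ)⌋₊)) ≤ κ' * dist u v + κ' := by
    intro u v huv
    have hduv : dist u v = v - u := by
      rw [Subtype.dist_eq, dist_comm, Real.dist_eq, abs_of_nonneg (by linarith)]
    have hm : ⌊(v : ℝ)⌋₊ ≤ m := by
      have := Nat.floor_mono v.2.2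
      simpa using this
    obtain ⟨h1, h2⟩ := hg _ _ (Nat.floor_mono huv) hm
    obtain ⟨h3, h4⟩ := hφ (g ⌊(u : ℝ)⌋₊) (g ⌊(v : ℝ)⌋₊)
    have f1 := Nat.floor_le u.2.1
    have f2 := Nat.lt_floor_add_one (u : ℝ)
    have f3 := Nat.floor_le v.2.1
    have f4 := Nat.lt_floor_add_one (v : ℝ)
    rw [hduv]
    have hΔ : (0 : ℝ) ≤ v - u := by linarith
    constructor
    · have e1 : 1 / κ' ≤ c / κ := by
        rw [← one_div_div κ c]
        exact one_div_le_one_div_of_le hκc (by linarith)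
      have e2 : 1 / κ' * ((v : ℝ) - u) ≤ c / κ * (v - u) := by gcongr
      have e3 : c / κ * ((v : ℝ) - u - 1) ≤ 1 / κ * dist (g ⌊(u : ℝ)⌋₊) (g ⌊(v : ℝ)⌋₊) := by
        rw [div_eq_mul_one_div, mul_comm c, mul_assoc]
        refine mul_le_mul_of_nonneg_left (le_trans ?_ h1) (by positivity)
        exact mul_le_mul_of_nonneg_left (by linarith) hc0.le
      have e4 : c / κ ≤ 1 := by
        rw [div_le_one (by linarith)]
        linarith
      linarith
    · have e1 : κ * dist (g ⌊(u : ℝ)⌋₊) (g ⌊(v : ℝ)⌋₊) ≤ κ * (v - u + 1) := by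
        gcongr
        linarith
      have e2 : κ * ((v : ℝ) - u) ≤ κ' * (v - u) := by
        gcongr
        linarith
      linarith
  refine ⟨fun u v => ?_, Nat.cast_nonneg m, ?_, ?_⟩
  · rcases le_total (u : ℝ) v with h | h
    · exact key u v h
    · have := key v u h
      rwa [dist_comm v u, dist_comm (φ (g ⌊(v : ℝ)⌋₊))] at this
  · simp
  · simp

/-- Discrete quasigeodesics with endpoints in a stable subspace stay close to the subspace: compare
them with a geodesic of the subspace. -/
theorem exists_near_of_isDiscreteQuasigeodesic (hY : IsIntegerGeodesic Y) {i : Y → X}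
    (hi : IsQIEmbedding i) (hft : QuasigeodesicsFellowTravel (Set.range i)) (c : ℝ) (hc0 : 0 < c)
    (hc1 : c ≤ 1) :
    ∃ D : ℝ, 0 < D ∧ ∀ (m : ℕ) (g : ℕ → X), IsDiscreteQuasigeodesic c m g →
      g 0 ∈ Set.range i → g m ∈ Set.range i → ∀ k ≤ m, ∃ a ∈ Set.range i, dist (g k) a < D := by
  obtain ⟨κ, c', hκ, hc', hiκ⟩ := hi
  have hκc : 0 < 1 / c := by positivity
  obtain ⟨D, hD, hclose⟩ := hft (1 / c + κ + c' + κ + 2) (by linarith)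
  refine ⟨D, hD, fun m g hg h0 hm k hk => ?_⟩
  obtain ⟨y₀, hy₀⟩ := h0
  obtain ⟨y₁, hy₁⟩ := hm
  obtain ⟨n, γ, hγ0, hγn, hγ⟩ := hY y₀ y₁
  have hγq : IsDiscreteQuasigeodesic 1 n γ := fun i j hij hj => by
    rw [hγ i j hij hj]
    simp
  have q₁ := hg.isQuasigeodesicBetween hc0 hc1 (φ := id) (κ := 1) (c' := 0) le_rfl le_rfl
    (fun a b => by simp) (κ' := 1 / c + κ + c' + κ + 2) (by linarith)
  have q₂ := hγq.isQuasigeodesicBetween one_pos le_rfl hκ hc'.le hiκ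
    (κ' := 1 / c + κ + c' + κ + 2) (by rw [div_one]; linarith)
  rw [hγ0, hγn, hy₀, hy₁] at q₂
  have hsub := (hclose 0 m 0 n _ _ (g 0) ⟨y₀, hy₀⟩ (g m) ⟨y₁, hy₁⟩ q₁ q₂).1
  have hk' : g k ∈ Set.range fun u : Set.Icc (0 : ℝ) m => id (g ⌊(u : ℝ)⌋₊) :=
    ⟨⟨k, Nat.cast_nonneg k, by exact_mod_cast hk⟩, by simp⟩
  obtain ⟨_, ⟨u, rfl⟩, hu⟩ := Metric.mem_thickening_iff.1 (hsub hk')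
  exact ⟨_, ⟨_, rfl⟩, hu⟩

/-- In an integer geodesic space nearest-point projections to nonempty sets exist. -/
theorem IsIntegerGeodesic.exists_nearest (hX : IsIntegerGeodesic X) {A : Set X} (hA : A.Nonempty)
    (x : X) : ∃ y ∈ A, ∀ a ∈ A, dist x y ≤ dist x a := by
  have hint : ∀ a, ∃ n : ℕ, dist x a = n := fun a => by
    obtain ⟨n, γ, h0, hn, h⟩ := hX x a
    exact ⟨n, by simpa [h0, hn] using h 0 n (Nat.zero_le _) le_rfl⟩
  choose N hN using hint
  obtain ⟨y, hy, hmin⟩ := WellFounded.has_min (measure N).wf A hA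
  exact ⟨y, hy, fun a ha => by rw [hN, hN]; exact_mod_cast not_lt.1 (hmin a ha)⟩

/-- The sample of the interval `[s, t]` at integer distance from the left endpoint, truncated at
the right endpoint. -/
noncomputable def sampleTime {s t : ℝ} (hst : s ≤ t) (k : ℕ) : Set.Icc s t :=
  ⟨min (s + k) t, le_min (by simp) hst, min_le_right _ _⟩

theorem dist_sampleTime_succ_le {s t : ℝ} (hst : s ≤ t) (k : ℕ) :
    dist (sampleTime hst k) (sampleTime hst (k + 1)) ≤ 1 := by
  rw [Subtype.dist_eq, Real.dist_eq, abs_le]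
  simp only [sampleTime]
  push_cast
  constructor <;> rcases min_cases (s + k) t with h | h <;>
    rcases min_cases (s + (k + 1)) t with h' | h' <;> linarith

theorem le_dist_sampleTime {s t : ℝ} (hst : s ≤ t) {i j : ℕ} (hj : j ≤ ⌈t - s⌉₊) :
    (j : ℝ) - i - 1 ≤ dist (sampleTime hst i) (sampleTime hst j) := by
  rw [Subtype.dist_eq, dist_comm, Real.dist_eq]
  refine le_trans ?_ (le_abs_self _)
  simp only [sampleTime]
  have h1 : (⌈t - s⌉₊ : ℝ) < t - s + 1 := Nat.ceil_lt_add_one (by linarith)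
  have h2 : (j : ℝ) ≤ ⌈t - s⌉₊ := by exact_mod_cast hj
  have h3 := min_le_left (s + i) t
  have h4 : s + j - 1 ≤ min (s + j) t := le_min (by linarith) (by linarith)
  linarith

theorem exists_sampleTime_near {s t : ℝ} (hst : s ≤ t) (u : Set.Icc s t) :
    ∃ k ≤ ⌈t - s⌉₊, dist u (sampleTime hst k) ≤ 1 := by
  have hu : 0 ≤ (u : ℝ) - s := by linarith [u.2.1]
  refine ⟨⌊(u : ℝ) - s⌋₊, ?_, ?_⟩
  · exact (Nat.floor_mono (by linarith [u.2.2])).trans (Nat.floor_le_ceil _)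
  · have h1 := Nat.floor_le hu
    have h2 := Nat.lt_floor_add_one ((u : ℝ) - s)
    rw [Subtype.dist_eq, Real.dist_eq]
    simp only [sampleTime]
    rw [min_eq_left (by linarith [u.2.2]), abs_le]
    constructor <;> linarith

variable {j : Y → Z} {f : Z → X} {Λ E : ℝ}

/-- Quasigeodesics of `Z` with endpoints in `Y` are mapped by `f` into a uniform neighbourhood of
`f (Y)`. An excursion away from `f (Y)` makes little progress in the projection by contraction; but
it has to make progress proportional to its length, because `Y` is undistorted in `X` and `f` is
uniformly proper. Hence excursions have bounded length. -/
theorem exists_bound_dist_of_quasigeodesic (hX : IsIntegerGeodesic X) (hY : IsIntegerGeodesic Y)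
    (hΛ : 0 < Λ) (hf : ∀ a b, dist (f a) (f b) ≤ Λ * dist a b)
    (hP : ∀ R : ℝ, ∃ R' : ℝ, ∀ a b, dist (f a) (f b) ≤ R → dist a b ≤ R') (hE0 : 0 < E)
    (hE : ∀ y y', dist (j y) (j y') ≤ E * dist (f (j y)) (f (j y')) + E)
    (hqi : IsQIEmbedding (f ∘ j)) (hft : QuasigeodesicsFellowTravel (Set.range (f ∘ j))) {κ : ℝ}
    (hκ : 1 ≤ κ) :
    ∃ M : ℝ, ∀ (s t : ℝ) (q : Set.Icc s t → Z), ∀ a ∈ Set.range j, ∀ b ∈ Set.range j,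
      IsQuasigeodesicBetween κ q a b → ∀ u, ∃ y, dist (f (q u)) (f (j y)) ≤ M := by
  rcases isEmpty_or_nonempty Y with hYe | hYn
  · exact ⟨0, fun _ _ _ a ⟨y, _⟩ => isEmptyElim y⟩
  set A := Set.range (f ∘ j) with hAdef
  have hAne : A.Nonempty := Set.range_nonempty _
  choose π hπA hπmin using hX.exists_nearest hAne
  have hπlip : ∀ x x', dist x (π x) ≤ dist x x' + dist x' (π x') := fun x x' =>
    (hπmin x _ (hπA x')).trans (dist_triangle _ _ _)
  set B := Λ * (2 * κ) with hB
  have hB0 : 0 < B := by positivity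
  -- The contraction rate beats the distortion `E` and the quasigeodesic constant `κ`.
  set ε := min 1 (1 / (8 * B * E * κ)) with hε
  have hε0 : 0 < ε := by positivity
  have hε1 : ε ≤ 1 := min_le_left _ _
  have hε2 : E * (4 * B * ε) ≤ 1 / (2 * κ) := by
    calc E * (4 * B * ε) ≤ E * (4 * B * (1 / (8 * B * E * κ))) := by
          gcongr
          exact min_le_right _ _
      _ = 1 / (2 * κ) := by field_simp; norm_num
  obtain ⟨R₀, hR₀, hcontr₀⟩ := exists_contraction hX
    (exists_near_of_isDiscreteQuasigeodesic hY hqi hft) hε0 hε1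
  set R := max R₀ (2 * B) with hR
  have hBR : 2 * B ≤ R := le_max_right _ _
  have hR0 : 0 < R := lt_of_lt_of_le hR₀ (le_max_left _ _)
  have hcontr : ∀ x x', R ≤ dist x (π x) → dist x x' ≤ dist x (π x) / 2 →
      dist (π x) (π x') ≤ ε * dist x (π x) := fun x x' h =>
    hcontr₀ x x' _ _ (hπA x) (hπA x') (hπmin x) (hπmin x') ((le_max_left _ _).trans h)
  obtain ⟨P, hPR⟩ := hP (R + B)
  set W := 2 / κ + κ + 2 * P + E * R + E with hW
  set N := ⌈2 * κ * W⌉₊ with hN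
  refine ⟨B + (R + B * N), fun s t q a ha b hb hq u => ?_⟩
  obtain ⟨hqq, hst, hqa, hqb⟩ := hq
  set n := ⌈t - s⌉₊ with hn
  set p : ℕ → X := fun k => f (q (sampleTime hst k)) with hp
  have hzero : ∀ z ∈ Set.range j, dist (f z) (π (f z)) ≤ R := by
    rintro _ ⟨y, rfl⟩
    have := hπmin (f (j y)) _ ⟨y, rfl⟩
    simp only [Function.comp_apply, dist_self] at this
    linarith
  have hp0 : p 0 = f a := by
    rw [← hqa]
    simp [hp, sampleTime, hst]
  have hpn : p n = f b := by
    have hsn : t ≤ s + n := by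
      have := Nat.le_ceil (t - s)
      linarith
    rw [← hqb]
    simp [hp, sampleTime, hsn]
  have hstep₁ : ∀ u v, dist u v ≤ 1 → dist (f (q u)) (f (q v)) ≤ B := fun u v huv => by
    refine (hf _ _).trans ?_
    rw [hB]
    gcongr
    have := (hqq u v).2
    nlinarith
  have hstep : ∀ k, dist (p k) (p (k + 1)) ≤ B := fun k =>
    hstep₁ _ _ (dist_sampleTime_succ_le hst k)
  have hbound := le_of_excursions_short (h := fun k => dist (p k) (π (p k))) (n := n) (N := N)
    (R := R) (B := B) hB0.le (by simpa only [hp0] using hzero a ha)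
    (by simpa only [hpn] using hzero b hb)
    (fun k _ => by
      have h1 := hπlip (p (k + 1)) (p k)
      have h2 := hstep k
      rw [dist_comm] at h2
      linarith) ?_
  · obtain ⟨k, hk, huk⟩ := exists_sampleTime_near hst u
    obtain ⟨y, hy⟩ := hπA (p k)
    refine ⟨y, ?_⟩
    have h1 := hbound k hk
    have h2 := hstep₁ _ _ huk
    have h3 := dist_triangle (f (q u)) (p k) (π (p k))
    rw [← hy] at h1 h3
    exact h3.trans (add_le_add h2 h1)
  · intro i l hil hln hi hl hout
    obtain ⟨y, hy⟩ := hπA (p (i + 1))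
    obtain ⟨y', hy'⟩ := hπA (p l)
    simp only [Function.comp_apply] at hy hy'
    have hnear : dist (p (i + 1)) (π (p (i + 1))) ≤ R + B := by
      have h1 := hπlip (p (i + 1)) (p i)
      have h2 := hstep i
      rw [dist_comm] at h2
      linarith
    have hproj := dist_proj_path_le hε0 hB0 hBR hπlip hcontr p (l - (i + 1)) (i + 1)
      (fun k hk hk' => (hout k (by omega) (by omega)).le) fun k _ _ => hstep k
    rw [show i + 1 + (l - (i + 1)) = l by omega] at hproj
    have hZ₁ := hPR (q (sampleTime hst (i + 1))) (j y) (by rw [hy]; exact hnear)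
    have hZ₂ := hPR (q (sampleTime hst l)) (j y') (by rw [hy']; linarith)
    have hlow := (hqq (sampleTime hst (i + 1)) (sampleTime hst l)).1
    have htime := le_dist_sampleTime hst (i := i + 1) hln
    have hEy := hE y y'
    rw [hy, hy'] at hEy
    have htri := dist_triangle4 (q (sampleTime hst (i + 1))) (j y) (j y')
      (q (sampleTime hst l))
    rw [dist_comm (j y') (q _)] at htri
    set d : ℝ := (l : ℝ) - i with hd
    have hcast : ((l - (i + 1) : ℕ) : ℝ) ≤ d := by
      rw [Nat.cast_sub (by omega)]
      push_cast
      linarith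
    have hd0 : 0 ≤ d := (Nat.cast_nonneg _).trans hcast
    have hproj' : dist (π (p (i + 1))) (π (p l)) ≤ 4 * B * ε * d + R := by
      refine hproj.trans (add_le_add (by gcongr) ?_)
      calc ε * dist (p l) (π (p l)) ≤ 1 * R := by gcongr
        _ = R := one_mul R
    have e1 : E * dist (π (p (i + 1))) (π (p l)) ≤ 1 / (2 * κ) * d + E * R := by
      calc E * dist (π (p (i + 1))) (π (p l)) ≤ E * (4 * B * ε * d + R) := by gcongr
        _ = E * (4 * B * ε) * d + E * R := by ring
        _ ≤ _ := by gcongr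
    have e2 : 1 / κ * (d - 2) ≤
        1 / κ * dist (sampleTime hst (i + 1)) (sampleTime hst l) := by
      gcongr
      push_cast at htime
      linarith
    have e3 : 1 / κ * (d - 2) - 1 / (2 * κ) * d = d / (2 * κ) - 2 / κ := by
      field_simp
      ring
    have e4 : d / (2 * κ) ≤ W := by linarith
    rw [div_le_iff₀ (by positivity), mul_comm] at e4
    have e5 : ((l - i : ℕ) : ℝ) ≤ N := by
      rw [Nat.cast_sub hil.le]
      exact e4.trans (Nat.le_ceil _)
    exact_mod_cast e5

/-- Fellow travelling of quasigeodesics is inherited by a metric space `Z` between the stable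
subspace `Y` and the ambient space `X`, when `Z` maps to `X` by a Lipschitz and uniformly proper
map. Quasigeodesics of `Z` are pushed to `Y`, where they are quasigeodesics of `X`. -/
theorem quasigeodesicsFellowTravel_of_comp (hX : IsIntegerGeodesic X) (hY : IsIntegerGeodesic Y)
    (hΛ : 0 < Λ) (hf : ∀ a b, dist (f a) (f b) ≤ Λ * dist a b)
    (hP : ∀ R : ℝ, ∃ R' : ℝ, ∀ a b, dist (f a) (f b) ≤ R → dist a b ≤ R') (hE0 : 0 < E)
    (hE : ∀ y y', dist (j y) (j y') ≤ E * dist (f (j y)) (f (j y')) + E)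
    (hqi : IsQIEmbedding (f ∘ j)) (hft : QuasigeodesicsFellowTravel (Set.range (f ∘ j))) :
    QuasigeodesicsFellowTravel (Set.range j) := by
  intro κ hκ
  obtain ⟨M, hM⟩ := exists_bound_dist_of_quasigeodesic hX hY hΛ hf hP hE0 hE hqi hft hκ.le
  obtain ⟨M', hM'⟩ := hP M
  have hκ0 : 0 < κ := by linarith
  set m := max M' 0 with hm
  have hm0 : 0 ≤ m := le_max_right _ _
  set κ' := E * κ + Λ * κ + (κ + 2 * m + E) / E + Λ * (κ + 2 * m) + 2 with hκ'
  have t1 : 0 < E * κ := by positivity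
  have t2 : 0 < Λ * κ := by positivity
  have t3 : 0 < (κ + 2 * m + E) / E := by positivity
  have t4 : 0 < Λ * (κ + 2 * m) := by positivity
  obtain ⟨D, hD, hclose⟩ := hft κ' (by linarith)
  obtain ⟨D', hD'⟩ := hP D
  have push : ∀ (s t : ℝ) (q : Set.Icc s t → Z), ∀ a ∈ Set.range j, ∀ b ∈ Set.range j,
      IsQuasigeodesicBetween κ q a b → ∃ y : Set.Icc s t → Y, (∀ u, dist (q u) (j (y u)) ≤ m) ∧
        IsQuasigeodesicBetween κ' (fun u => f (j (y u))) (f a) (f b) := by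
    intro s t q a ha b hb hq
    -- The endpoints must not be moved, so points of `Y` are kept.
    have hex : ∀ u, ∃ y, dist (q u) (j y) ≤ m ∧ (q u ∈ Set.range j → j y = q u) := by
      intro u
      by_cases hu : q u ∈ Set.range j
      · obtain ⟨y, hy⟩ := hu
        exact ⟨y, by rw [hy, dist_self]; exact hm0, fun _ => hy⟩
      · obtain ⟨y, hy⟩ := hM s t q a ha b hb hq u
        exact ⟨y, (hM' _ _ hy).trans (le_max_left _ _), fun h => absurd h hu⟩
    choose y hy hyj using hex
    obtain ⟨hqq, hst, hqa, hqb⟩ := hq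
    refine ⟨y, hy, fun u v => ?_, hst, ?_, ?_⟩
    · obtain ⟨h1, h2⟩ := hqq u v
      have h3 := dist_triangle4 (q u) (j (y u)) (j (y v)) (q v)
      have h4 := dist_triangle4 (j (y u)) (q u) (q v) (j (y v))
      rw [dist_comm (j (y v))] at h3
      rw [dist_comm (j (y u)) (q u)] at h4
      have h5 := hE (y u) (y v)
      have h6 := hf (j (y u)) (j (y v))
      have h7 := hy u
      have h8 := hy v
      have hd : 0 ≤ dist u v := dist_nonneg
      constructor
      · have e1 : 1 / κ' * dist u v ≤ 1 / (E * κ) * dist u v := by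
          gcongr
          linarith
        have e2 : 1 / κ * dist u v - (κ + 2 * m + E) ≤
            E * dist (f (j (y u))) (f (j (y v))) := by linarith
        have e3 : 1 / (E * κ) * dist u v - (κ + 2 * m + E) / E ≤
            dist (f (j (y u))) (f (j (y v))) := by
          rw [← div_le_iff₀' hE0] at e2
          refine le_of_eq_of_le ?_ e2
          field_simp
        linarith
      · have e1 : Λ * dist (j (y u)) (j (y v)) ≤ Λ * (κ * dist u v + κ + 2 * m) := by
          gcongr
          linarith
        have e2 : Λ * κ * dist u v ≤ κ' * dist u v := by
          gcongr
          linarith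
        linarith
    · have := hyj ⟨s, Set.left_mem_Icc.2 hst⟩ (hqa ▸ ha)
      simp only [this, hqa]
    · have := hyj ⟨t, Set.right_mem_Icc.2 hst⟩ (hqb ▸ hb)
      simp only [this, hqb]
  have hD'0 : 0 < 2 * m + max D' 0 + 1 := by
    have := le_max_right D' 0
    linarith
  refine ⟨2 * m + max D' 0 + 1, hD'0, fun s t s' t' q q' a ha b hb hq hq' => ?_⟩
  obtain ⟨y, hy, hyq⟩ := push s t q a ha b hb hq
  obtain ⟨y', hy', hyq'⟩ := push s' t' q' a ha b hb hq'
  have hfA : ∀ z ∈ Set.range j, f z ∈ Set.range (f ∘ j) := by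
    rintro _ ⟨y, rfl⟩
    exact ⟨y, rfl⟩
  obtain ⟨hc₁, hc₂⟩ := hclose s t s' t' _ _ _ (hfA a ha) _ (hfA b hb) hyq hyq'
  have hpull : ∀ u v, dist (f (j (y u))) (f (j (y' v))) < D →
      dist (q u) (q' v) < 2 * m + max D' 0 + 1 := by
    intro u v huv
    have h1 := hD' _ _ huv.le
    have h2 := dist_triangle4 (q u) (j (y u)) (j (y' v)) (q' v)
    rw [dist_comm (j (y' v))] at h2
    have h3 := hy u
    have h4 := hy' v
    have h5 := le_max_left D' 0
    linarith
  constructor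
  · rintro _ ⟨u, rfl⟩
    obtain ⟨_, ⟨v, rfl⟩, huv⟩ := Metric.mem_thickening_iff.1 (hc₁ ⟨u, rfl⟩)
    exact Metric.mem_thickening_iff.2 ⟨_, ⟨v, rfl⟩, hpull u v huv⟩
  · rintro _ ⟨v, rfl⟩
    obtain ⟨_, ⟨u, rfl⟩, huv⟩ := Metric.mem_thickening_iff.1 (hc₂ ⟨v, rfl⟩)
    refine Metric.mem_thickening_iff.2 ⟨_, ⟨u, rfl⟩, ?_⟩
    rw [dist_comm] at huv ⊢
    exact hpull u v huv

end PullingBack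

/-! ### Word metrics -/

section WordMetricGeometry

variable {G K : Type*} [Group G] [Group K]

theorem FinGenSet.isIntegerGeodesic (S : FinGenSet G) : IsIntegerGeodesic S.Space := by
  intro (x : G) (y : G)
  obtain ⟨l, hl, hprod, hlen⟩ := S.exists_word (x⁻¹ * y)
  let w : ℕ → G := fun i => x * (l.take i).prod
  let γ : ℕ → S.Space := w
  have hle : ∀ i j, i ≤ j → dist (γ i) (γ j) ≤ (j : ℝ) - i := by
    intro i j hij
    have h1 : wordDist S.carrier (w i) (w j) ≤ j - i := by
      have hsplit : l.take j = l.take i ++ (l.drop i).take (j - i) := by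
        rw [← List.take_add, Nat.add_sub_cancel' hij]
      have : wordDist S.carrier (w i) (w j) =
          wordNorm S.carrier ((l.drop i).take (j - i)).prod := by
        simp only [wordDist, w, hsplit, List.prod_append]
        congr 1
        group
      rw [this]
      refine (wordNorm_le fun z hz => hl z ?_).trans (List.length_take_le _ _)
      exact List.mem_of_mem_drop (List.mem_of_mem_take hz)
    rw [← Nat.cast_sub hij]
    exact Nat.cast_le.2 h1
  have h0 : w 0 = x := by simp [w]
  have hn : w l.length = y := by simp [w, hprod]
  refine ⟨l.length, γ, h0, hn, fun i j hij hj => le_antisymm (hle i j hij) ?_⟩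
  -- A subpath of a path of minimal length has minimal length.
  have h1 := hle 0 i (Nat.zero_le _)
  have h2 := hle j l.length hj
  have h3 := dist_triangle4 (γ 0) (γ i) (γ j) (γ l.length)
  have h4 : dist (γ 0) (γ l.length) = l.length := by
    change (wordDist S.carrier (w 0) (w l.length) : ℝ) = _
    rw [h0, hn, hlen, wordDist]
  push_cast at h1
  linarith

/-- Homomorphisms are Lipschitz for word metrics. -/
theorem FinGenSet.exists_dist_map_le (S : FinGenSet G) (T : FinGenSet K) (φ : G →* K) :
    ∃ Λ : ℝ, 0 < Λ ∧ ∀ a b : G,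
      (wordDist T.carrier (φ a) (φ b) : ℝ) ≤ Λ * wordDist S.carrier a b := by
  obtain ⟨C, hC⟩ := (S.finite.image fun x => wordNorm T.carrier (φ x)).bddAbove
  have hC' : ∀ x, x ∈ S.carrier ∨ x⁻¹ ∈ S.carrier → wordNorm T.carrier (φ x) ≤ C := by
    rintro x (hx | hx)
    · exact hC ⟨x, hx, rfl⟩
    · have h1 := T.wordNorm_inv_le (φ x⁻¹)
      rw [map_inv, inv_inv, ← map_inv] at h1
      exact h1.trans (hC ⟨x⁻¹, hx, rfl⟩)
  have hword : ∀ l : List G, IsWord S.carrier l →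
      wordNorm T.carrier (φ l.prod) ≤ C * l.length := by
    intro l
    induction l with
    | nil => simp [wordNorm_one]
    | cons x l ih =>
      intro hl
      rw [List.prod_cons, map_mul, List.length_cons]
      have h1 := ih fun z hz => hl z (List.mem_cons_of_mem _ hz)
      have h2 := hC' x (hl x List.mem_cons_self)
      have h3 := T.wordNorm_mul_le (φ x) (φ l.prod)
      rw [mul_add, mul_one]
      omega
  refine ⟨C + 1, by positivity, fun a b => ?_⟩
  obtain ⟨l, hl, hprod, hlen⟩ := S.exists_word (a⁻¹ * b)
  have h1 := hword l hl
  rw [hprod, hlen, map_mul, map_inv] at h1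
  have h2 : (wordDist T.carrier (φ a) (φ b) : ℝ) ≤ C * wordDist S.carrier a b := by
    exact_mod_cast h1
  exact h2.trans (by gcongr; linarith)

theorem FinGenSet.finite_wordNorm_le (S : FinGenSet G) (n : ℕ) :
    {g : G | wordNorm S.carrier g ≤ n}.Finite := by
  set U : Set G := S.carrier ∪ S.carrier⁻¹ with hU
  have hUf : U.Finite := S.finite.union S.finite.inv
  have hlists : {l : List G | l.length ≤ n ∧ ∀ x ∈ l, x ∈ U}.Finite := by
    have := hUf.to_subtype
    refine ((List.finite_length_le U n).image (List.map Subtype.val)).subset ?_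
    rintro l ⟨hl, hlU⟩
    exact ⟨l.attach.map fun x => ⟨x.1, hlU x.1 x.2⟩, by simpa using hl, by simp⟩
  refine (hlists.image List.prod).subset fun g hg => ?_
  obtain ⟨l, hl, hprod, hlen⟩ := S.exists_word g
  exact ⟨l, ⟨hlen.trans_le hg, fun x hx => hl x hx⟩, hprod⟩

/-- Injective homomorphisms are uniformly proper for word metrics, since balls are finite and the
metrics are left-invariant. -/
theorem FinGenSet.exists_dist_le_of_dist_map_le (S : FinGenSet G) (T : FinGenSet K) {φ : G →* K}
    (hφ : Function.Injective φ) (R : ℝ) :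
    ∃ R' : ℝ, ∀ a b : G, (wordDist T.carrier (φ a) (φ b) : ℝ) ≤ R →
      (wordDist S.carrier a b : ℝ) ≤ R' := by
  obtain ⟨C, hC⟩ := (((T.finite_wordNorm_le ⌊R⌋₊).preimage hφ.injOn).image
    (wordNorm S.carrier)).bddAbove
  refine ⟨C, fun a b hab => Nat.cast_le.2 (hC ⟨a⁻¹ * b, ?_, rfl⟩)⟩
  change wordNorm T.carrier (φ (a⁻¹ * b)) ≤ ⌊R⌋₊
  rw [map_mul, map_inv]
  exact Nat.le_floor hab

end WordMetricGeometry

end SubgroupStability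

/-! ### Stability in an intermediate group -/

/-- If `H ≤ L ≤ G` with all three groups finitely generated, and `H` is stable in `G` with respect
to some choice of finite generating sets, then `H` is stable in `L` with respect to every choice of
finite generating sets. -/
theorem theorem1p6 {G : Type*} [Group G] (hG : Group.FG G) (H L : Subgroup G) (hHL : H ≤ L)
    (hH : H.FG) (hL : L.FG)
    (hstable : ∃ (T : SubgroupStability.FinGenSet H) (S : SubgroupStability.FinGenSet G),
      SubgroupStability.IsStableSubgroupWith H T S) :
    ∀ (T : SubgroupStability.FinGenSet (H.subgroupOf L)) (S : SubgroupStability.FinGenSet L),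
      SubgroupStability.IsStableSubgroupWith (H.subgroupOf L) T S := by
  open SubgroupStability in
  intro T S
  obtain ⟨T₀, S₀, ⟨-, κ, c, hκ, hc, hqi⟩, hft⟩ := hstable
  let e := Subgroup.subgroupOfEquivOfLe hHL
  let e' : T.Space → T₀.Space := e
  let j : T.Space → S.Space := inclusion T S
  let f : S.Space → S₀.Space := inclusion S S₀
  have hfj : ∀ y, f (j y) = inclusion T₀ S₀ (e' y) := fun _ => rfl
  obtain ⟨Λ, hΛ, hf⟩ : ∃ Λ : ℝ, 0 < Λ ∧ ∀ a b, dist (f a) (f b) ≤ Λ * dist a b :=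
    S.exists_dist_map_le S₀ L.subtype
  obtain ⟨Λ₁, hΛ₁, hj⟩ : ∃ Λ : ℝ, 0 < Λ ∧ ∀ a b, dist (j a) (j b) ≤ Λ * dist a b :=
    T.exists_dist_map_le S (H.subgroupOf L).subtype
  obtain ⟨Λ₂, hΛ₂, he⟩ : ∃ Λ : ℝ, 0 < Λ ∧ ∀ a b, dist a b ≤ Λ * dist (e' a) (e' b) := by
    obtain ⟨Λ₂, hΛ₂, he⟩ := T₀.exists_dist_map_le T e.symm.toMonoidHom
    refine ⟨Λ₂, hΛ₂, fun (a b : H.subgroupOf L) => ?_⟩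
    have h : (wordDist T.carrier (e.symm (e a)) (e.symm (e b)) : ℝ) ≤
      Λ₂ * wordDist T₀.carrier (e a) (e b) := he (e a) (e b)
    rw [e.symm_apply_apply, e.symm_apply_apply] at h
    exact h
  -- The generating set of `H` may be replaced by the given one.
  have hlow : ∀ y y' : T.Space, dist y y' ≤
      Λ₂ * κ * dist (f (j y)) (f (j y')) + Λ₂ * κ * c := by
    intro y y'
    have h1 := (hqi (e' y) (e' y')).1
    rw [← hfj, ← hfj] at h1
    have h2 : dist (e' y) (e' y') ≤ κ * (dist (f (j y)) (f (j y')) + c) := by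
      rw [← div_le_iff₀' (by linarith), div_eq_mul_one_div, mul_comm]
      linarith
    calc dist y y' ≤ Λ₂ * (κ * (dist (f (j y)) (f (j y')) + c)) := (he y y').trans (by gcongr)
      _ = _ := by ring
  have hup : ∀ y y' : T.Space, dist (f (j y)) (f (j y')) ≤ Λ * Λ₁ * dist y y' := by
    intro y y'
    rw [mul_assoc]
    exact (hf _ _).trans (mul_le_mul_of_nonneg_left (hj y y') hΛ.le)
  have hκ0 : 0 < κ := by linarith
  have hqij : IsQIEmbedding j := by
    refine .of_dist_le (C := Λ₂ * κ * Λ) (C' := Λ₂ * κ * c) (C'' := Λ₁) (by positivity)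
      (by positivity) hΛ₁ (fun y y' => (hlow y y').trans ?_) hj
    rw [mul_assoc _ Λ]
    gcongr
    exact hf _ _
  have hqifj : IsQIEmbedding (f ∘ j) :=
    .of_dist_le (by positivity) (by positivity) (by positivity) hlow hup
  have hrange : Set.range (f ∘ j) = Set.range (inclusion T₀ S₀) :=
    e.surjective.range_comp (inclusion T₀ S₀)
  refine ⟨⟨fun _ _ h => (H.subgroupOf L).subtype_injective h, hqij⟩, ?_⟩
  refine quasigeodesicsFellowTravel_of_comp (f := f) (E := Λ₁ * (Λ₂ * κ) + Λ₁ * (Λ₂ * κ * c))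
    S₀.isIntegerGeodesic T.isIntegerGeodesic hΛ hf
    (S.exists_dist_le_of_dist_map_le S₀ L.subtype_injective) (by positivity) (fun y y' => ?_)
    hqifj (hrange ▸ hft)
  have h1 : dist (j y) (j y') ≤
      Λ₁ * (Λ₂ * κ * dist (f (j y)) (f (j y')) + Λ₂ * κ * c) :=
    (hj y y').trans (mul_le_mul_of_nonneg_left (hlow y y') hΛ₁.le)
  have h2 : 0 ≤ Λ₁ * (Λ₂ * κ * c) * dist (f (j y)) (f (j y')) := by positivity
  have h3 : 0 ≤ Λ₁ * (Λ₂ * κ) := by positivity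
  linarith
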